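/- Consider families of operators $\mathcal T_s:\ell^2(\mathbb Z)\to\ell^2(\mathbb Z)$, $s\ge 0$, on real signals. The discrete scale-space axioms are: (A1) $\mathcal T_s$ is linear and commutes with shifts, and there is $K_s\in\ell^1(\mathbb Z)$ with $\mathcal T_s x=K_s*x$ for all $x$; (A2) $\mathcal T_0=\mathrm{Id}$ and $\mathcal T_{s+t}=\mathcal T_s\circ\mathcal T_t$ for $s,t\ge0$; (A3) $s\mapsto K_s$ is $C^1$ from $[0,\infty)$ to $\ell^1(\mathbb Z)$; (A4) $\sum_n K_s[n]=1$ for all $s\ge0$; (A5) for every $x\in\ell^2(\mathbb Z)$ and $s\ge0$, $y[\cdot;s]=\mathcal T_sx$ satisfies $\partial_s y[n;s]\le 0$ whenever $y[n;s]\ge y[n\pm1;s]$, and $\partial_s y[n;s]\ge0$ whenever $y[n;s]\le y[n\pm1;s]$ (with a one-sided derivative at $s=0$); (A6) $K_s[n]=K_s[-n]$ for all $n\in\mathbb Z$, $s\ge0$. The family $\{\mathcal T_s\}_{s\ge 0}$ is a generalized scaling operator family if $s\mapsto\mathcal T_sx$ is $C^1$ from $[0,\infty)$ to $\ell^2(\mathbb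 Z)$ for every $x$, and for all positive integers $s$ and all integers $m>1$: $\|\mathcal T_sx-\mathcal T_sx'\|_2\le\|x-x'\|_2$ for all $x,x'$; $\|\mathcal T_{ms}x\|_2\le\|\mathcal T_sx\|_2$ for all $x$; and this last inequality is strict for some $x$. Theorem. Let $I_k$ denote the modified Bessel function of the first kind of order $k$. 1. For every $\alpha>0$ there is a generalized scaling operator family satisfying (A1)–(A6) whose kernels are the discrete Gaussian $K_s[n]=e^{-\alpha s}I_{|n|}(\alpha s)$, $s\ge0$, $n\in\mathbb Z$. 2. Conversely, for every generalized scaling operator family satisfying (A1)–(A6) there is exactly one $\alpha>0$ with $K_s[n]=e^{-\alpha s}I_{|n|}(\alpha s)$ for all $s\ge0$ and $n\in\mathbb Z$. In particular, for any two such families $\mathcal T,\mathcal T'$ with kernels $K,K'$ there is $c>0$ with $\mathcal T'_s=\mathcal T_{cs}$ and $K'_s=K_{cs}$ for all $s\ge0$. 3. A family satisfying (A1)–(A6) is a generalized scaling operator family if and only if it is not the trivial family $\mathcal T_s=\mathrm{Id}$ for all $s\ge0$. 4. For $\alpha>0$, $s\ge0$ and $k\in\ell^1(\mathbb Z)$ real,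 one has $k[n]=e^{-\alpha s}I_{|n|}(\alpha s)$ for all $n\in\mathbb Z$ if and only if $\widehat k(\omega)=\sum_{n}k[n]e^{-in\omega}=\exp(\alpha s(\cos\omega-1))$ for all $\omega\in[-\pi,\pi]$, and equivalently if and only if $\widehat k(\omega)=\exp(-2\alpha s\sin^2(\omega/2))$ for all $\omega\in[-\pi,\pi]$. -/

import Mathlib

open scoped ENNReal

noncomputable section

namespace ScaleSpace

/-- Real square-summable signals on `ℤ`, with the `ℓ²` norm. -/
abbrev L2Z : Type := lp (fun _ : ℤ => ℝ) 2

/-- Real absolutely summable kernels on `ℤ`, with the `ℓ¹` norm. -/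
abbrev L1Z : Type := lp (fun _ : ℤ => ℝ) 1

/-- `n` is a local maximum of the signal `y`: its value is at least that of both neighbours.
(The topological `IsLocalMax` is void on the discrete space `ℤ`.) -/
def IsDiscreteLocalMax (y : ℤ → ℝ) (n : ℤ) : Prop :=
  y (n - 1) ≤ y n ∧ y (n + 1) ≤ y n

/-- `n` is a local minimum of the signal `y`: its value is at most that of both neighbours. -/
def IsDiscreteLocalMin (y : ℤ → ℝ) (n : ℤ) : Prop :=
  y n ≤ y (n - 1) ∧ y n ≤ y (n + 1)

/-- The discrete scale-space axioms for a family `T s`, `s ≥ 0`, of operators on `ℓ²(ℤ)` with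
convolution kernels `K s` in `ℓ¹(ℤ)`. The values of `T` and `K` at negative `s` play no role. The
kernel `K s` is determined by `T s`, being its impulse response. -/
structure DiscreteScaleSpaceAxioms (T : ℝ → L2Z → L2Z) (K : ℝ → L1Z) : Prop where
  /-- linearity -/
  linear : ∀ s, 0 ≤ s → IsLinearMap ℝ (T s)
  /-- shift invariance: if `x'` is `x` shifted by `k`, then `T s x'` is `T s x` shifted by `k` -/
  shift_invariant : ∀ s, 0 ≤ s → ∀ (k : ℤ) (x x' : L2Z),
    (∀ n, x' n = x (n - k)) → ∀ n, T s x' n = T s x (n - k)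
  /-- `T s` is convolution with `K s` -/
  convolution : ∀ s, 0 ≤ s → ∀ (x : L2Z) (n : ℤ), T s x n = ∑' m : ℤ, K s m * x (n - m)
  /-- identity at scale `0` -/
  zero : ∀ x, T 0 x = x
  /-- semigroup property -/
  semigroup : ∀ s t, 0 ≤ s → 0 ≤ t → ∀ x, T (s + t) x = T s (T t x)
  /-- the kernel is `C¹` in the scale, in the `ℓ¹` topology (one-sided at scale `0`) -/
  regularity : ContDiffOn ℝ 1 K (Set.Ici 0)
  /-- DC normalization -/
  normalization : ∀ s, 0 ≤ s → ∑' n : ℤ, K s n = 1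
  /-- non-enhancement of local maxima (the derivative is one-sided at scale `0`) -/
  nonenhancement_max : ∀ (x : L2Z) (s : ℝ), 0 ≤ s → ∀ n : ℤ, IsDiscreteLocalMax (T s x) n →
    derivWithin (fun t : ℝ => T t x n) (Set.Ici 0) s ≤ 0
  /-- non-enhancement of local minima (the derivative is one-sided at scale `0`) -/
  nonenhancement_min : ∀ (x : L2Z) (s : ℝ), 0 ≤ s → ∀ n : ℤ, IsDiscreteLocalMin (T s x) n →
    0 ≤ derivWithin (fun t : ℝ => T t x n) (Set.Ici 0) s
  /-- symmetry -/
  symmetric : ∀ s, 0 ≤ s → ∀ n : ℤ, K s n = K s (-n)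

/-- A scaling operator family, indexed by the positive integers: non-expansive, and energy
reducing along multiples of the scale, strictly for some input. -/
structure IsScalingFamily {E F : Type*} [NormedAddCommGroup E] [NormedAddCommGroup F]
    (f : ℕ → E → F) : Prop where
  nonexpansive : ∀ s, 1 ≤ s → ∀ x x' : E, ‖f s x - f s x'‖ ≤ ‖x - x'‖
  energy_le : ∀ s m, 1 ≤ s → 1 < m → ∀ x : E, ‖f (m * s) x‖ ≤ ‖f s x‖
  energy_lt : ∀ s m, 1 ≤ s → 1 < m → ∃ x : E, ‖f (m * s) x‖ < ‖f s x‖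

/-- A generalized scaling operator family with one continuous scale parameter `s ≥ 0`. -/
structure IsGeneralizedScalingFamily {E F : Type*} [NormedAddCommGroup E]
    [NormedAddCommGroup F] [NormedSpace ℝ F] (f : ℝ → E → F) : Prop where
  /-- the restriction to positive integer scales is a scaling operator family -/
  consistency : IsScalingFamily (fun s : ℕ => f (s : ℝ))
  /-- the output is continuously differentiable in the scale (one-sided at scale `0`) -/
  differentiability : ∀ x : E, ContDiffOn ℝ 1 (fun s : ℝ => f s x) (Set.Ici 0)

/-- The modified Bessel function of the first kind `I_k` of integer order `k ≥ 0`, by its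
everywhere convergent power series. -/
def besselI (k : ℕ) (z : ℝ) : ℝ :=
  ∑' j : ℕ, (z / 2) ^ (2 * j + k) / ((j.factorial : ℝ) * ((j + k).factorial : ℝ))

/-- The discrete Gaussian kernel at scale `t`: `n ↦ e^{-t} I_{|n|}(t)`. -/
def discreteGaussian (t : ℝ) (n : ℤ) : ℝ :=
  Real.exp (-t) * besselI n.natAbs t

/-- The Fourier symbol (discrete-time Fourier transform) `ω ↦ ∑ₙ k[n] e^{-inω}` of a kernel. -/
def fourierSymbol (k : L1Z) (ω : ℝ) : ℂ :=
  ∑' n : ℤ, (k n : ℂ) * Complex.exp (-(Complex.I * (n : ℂ) * (ω : ℂ)))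

end ScaleSpace

end

/-!
The discrete Gaussians are the coefficients of one generating function. If `U : ℤ → A` turns
addition into multiplication in a Banach algebra `A`, then multiplying the exponential series of
`(t / 2) • U 1` and `(t / 2) • U (-1)` and collecting the terms with the same power `U n` gives

  `∑ₙ discreteGaussian t n • U n = exp (t • ((U 1 + U (-1)) / 2 - 1))`

(`hasSum_discreteGaussian_smul`). With `U = 1` this is the normalization of the kernel, with
`U n = (-1) ^ n` it shows that the kernel determines `t`, with `U n = e^{-inω}` it is the Fourier
symbol, and with `U` the translations of `ℓᵖ(ℤ)` it says that convolution with the discrete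
Gaussian is the semigroup generated by half the second difference operator (`heatSemigroup`).
Applied to the unit impulse of `ℓ¹(ℤ)`, this semigroup is the kernel itself, which is therefore
smooth in the scale; on `ℓ²(ℤ)` it is the scale-space family. Non-enhancement holds because the
derivative in the scale is a positive multiple of the second difference.

Conversely, let `K` satisfy the axioms, with derivative `a ∈ ℓ¹(ℤ)` at scale `0`. The operators
`T s` form a semigroup that is right differentiable in operator norm, so `T s = exp (s • A)` with
`A` the convolution with `a` (`eq_exp_of_rightDeriv`). Non-enhancement at scale `0`, tested on unit
impulses away from the origin and its neighbours, for which the origin is both a local maximum and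
a local minimum, forces `a m = 0` for `|m| ≥ 2`; symmetry, `∑ a = 0` and the impulse at the origin
then leave only `A = β • ((U 1 + U (-1)) / 2 - 1)` with `β ≥ 0`
(`exists_convolutionCLM_eq_smul_diffusionGenerator`).

Finally the energy `‖T s x‖ ^ 2` has derivative `-β * ‖U 1 y - y‖ ^ 2` at `y = T s x`, which is
negative for `β > 0` and `x ≠ 0` since no nonzero square-summable signal is constant. Hence all
the scaling properties hold if `β > 0` (`strictAnti_norm_heatSemigroup`), while `β = 0` gives the
trivial family. That the Fourier symbol determines the kernel follows by integrating it termwise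
against `e^{imω}` (`eq_zero_of_fourierSymbol_eq_zero`).
-/

namespace ScaleSpace

open NormedSpace Set

/-! ### The generating function of the discrete Gaussian -/

/-- The pairs `(j, k)` of natural numbers, sorted by their difference: `(n, i)` corresponds to the
pair with difference `n` and minimum `i`. -/
def pairEquiv : ℤ × ℕ ≃ ℕ × ℕ where
  toFun q := (q.2 + q.1.toNat, q.2 + (-q.1).toNat)
  invFun q := ((q.1 : ℤ) - q.2, min q.1 q.2)
  left_inv q := by
    ext
    · simp
    · simp; omega
  right_inv q := by
    ext <;> (simp; omega)

theorem hasSum_mul_of_summable_norm {A : Type*} [NormedRing A] [CompleteSpace A] {f g : ℕ → A}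
    {a b : A} (hf : Summable fun j => ‖f j‖) (hg : Summable fun j => ‖g j‖) (ha : HasSum f a)
    (hb : HasSum g b) : HasSum (fun q : ℕ × ℕ => f q.1 * g q.2) (a * b) :=
  ha.mul hb (summable_mul_of_summable_norm hf hg)

theorem pow_eq_of_map_add {M : Type*} [Monoid M] {U : ℤ → M} (h0 : U 0 = 1)
    (hadd : ∀ m n, U (m + n) = U m * U n) (k : ℤ) (j : ℕ) : U k ^ j = U (j * k) := by
  induction j with
  | zero => simp [h0]
  | succ j ih => rw [pow_succ, ih, ← hadd]; congr 1; push_cast; ring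

section
variable {A : Type*} [NormedRing A] [NormedAlgebra ℝ A] [CompleteSpace A]

/-- Half the second difference, `(U 1 + U (-1)) / 2 - 1`, for a family `U` that stands for the powers
of an invertible element of a Banach algebra. -/
noncomputable def diffusionGenerator (U : ℤ → A) : A := (1 / 2 : ℝ) • (U 1 + U (-1)) - 1

/-- The generating function `∑ₙ I_{|n|}(t) uⁿ = exp ((t / 2) (u + u⁻¹))` of the modified Bessel
functions, in any Banach algebra. -/
theorem hasSum_besselI_smul {U : ℤ → A} (h0 : U 0 = 1) (hadd : ∀ m n, U (m + n) = U m * U n)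
    (t : ℝ) :
    HasSum (fun n : ℤ => besselI n.natAbs t • U n) (exp ((t / 2) • (U 1 + U (-1)))) := by
  let _ := NormedAlgebra.restrictScalars ℚ ℝ A
  have hcomm : Commute ((t / 2) • U 1) ((t / 2) • U (-1)) := by
    refine Commute.smul_left (Commute.smul_right ?_ _) _
    rw [Commute, SemiconjBy, ← hadd, ← hadd, add_comm]
  have hprod : HasSum (fun q : ℕ × ℕ =>
      (((q.1.factorial : ℝ)⁻¹ • ((t / 2) • U 1) ^ q.1) *
        ((q.2.factorial : ℝ)⁻¹ • ((t / 2) • U (-1)) ^ q.2)))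
      (exp ((t / 2) • (U 1 + U (-1)))) := by
    rw [smul_add, exp_add_of_commute hcomm]
    exact hasSum_mul_of_summable_norm
      (f := fun j : ℕ => (j.factorial : ℝ)⁻¹ • ((t / 2) • U 1) ^ j)
      (g := fun j : ℕ => (j.factorial : ℝ)⁻¹ • ((t / 2) • U (-1)) ^ j)
      (norm_expSeries_summable' _) (norm_expSeries_summable' _)
      (exp_series_hasSum_exp' _) (exp_series_hasSum_exp' _)
  -- The Bessel series has to be summable: its `tsum` would otherwise be the junk value `0`.
  have hreal (n : ℤ) : Summable fun i : ℕ =>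
      (t / 2) ^ (2 * i + n.natAbs) / ((i.factorial : ℝ) * ((i + n.natAbs).factorial : ℝ)) := by
    have h : Summable fun i : ℕ => |t / 2| ^ n.natAbs * ((t / 2) ^ 2) ^ i / (i.factorial : ℝ) := by
      simp only [mul_div_assoc]
      exact (Real.summable_pow_div_factorial _).mul_left _
    refine Summable.of_norm_bounded h fun i => ?_
    rw [Real.norm_eq_abs, abs_div, abs_pow, abs_of_nonneg (a := (_ * _ : ℝ)) (by positivity), pow_add,
      pow_mul, sq_abs, mul_comm (((t / 2) ^ 2) ^ i)]
    gcongr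
    exact le_mul_of_one_le_right (by positivity) (mod_cast Nat.one_le_iff_ne_zero.2
      (Nat.factorial_ne_zero _))
  refine ((pairEquiv.hasSum_iff.2 hprod).prod_fiberwise (g := fun n : ℤ => besselI n.natAbs t • U n)
    fun n => ?_)
  convert! (hreal n).hasSum.smul_const (U n) using 2 with i
  simp only [Function.comp, pairEquiv, Equiv.coe_fn_mk, smul_pow, pow_eq_of_map_add h0 hadd, smul_smul,
    smul_mul_smul_comm, ← hadd]
  congr 1
  · rcases le_total 0 n with h | h
    · obtain ⟨m, rfl⟩ := Int.eq_ofNat_of_zero_le h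
      simp
      field_simp
      ring
    · obtain ⟨m, hm⟩ := Int.eq_ofNat_of_zero_le (neg_nonneg.2 h)
      obtain rfl : n = -(m : ℤ) := by omega
      simp
      field_simp
      ring
  · congr 1; push_cast; omega

theorem hasSum_discreteGaussian_smul {U : ℤ → A} (h0 : U 0 = 1)
    (hadd : ∀ m n, U (m + n) = U m * U n) (t : ℝ) :
    HasSum (fun n : ℤ => discreteGaussian t n • U n) (exp (t • diffusionGenerator U)) := by
  let _ := NormedAlgebra.restrictScalars ℚ ℝ A
  have h := (hasSum_besselI_smul h0 hadd t).const_smul (Real.exp (-t))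
  have e : exp (t • diffusionGenerator U) =
      Real.exp (-t) • exp ((t / 2) • (U 1 + U (-1))) := by
    have : t • diffusionGenerator U = algebraMap ℝ A (-t) + (t / 2) • (U 1 + U (-1)) := by
      rw [diffusionGenerator, Algebra.algebraMap_eq_smul_one]; module
    rw [this, exp_add_of_commute (Algebra.commutes _ _), ← algebraMap_exp_comm,
      ← Real.exp_eq_exp_ℝ, ← Algebra.smul_def]
  rw [e]
  simpa only [discreteGaussian, smul_smul] using h

end

theorem discreteGaussian_neg (t : ℝ) (n : ℤ) : discreteGaussian t (-n) = discreteGaussian t n := by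
  simp [discreteGaussian]

theorem hasSum_discreteGaussian (t : ℝ) : HasSum (discreteGaussian t) 1 := by
  have h := hasSum_discreteGaussian_smul (A := ℝ) (U := fun _ => 1) rfl (by simp) t
  norm_num [diffusionGenerator] at h
  exact h

theorem hasSum_discreteGaussian_alternating (t : ℝ) :
    HasSum (fun n : ℤ => discreteGaussian t n * ((n.negOnePow : ℤ) : ℝ)) (Real.exp (-2 * t)) := by
  have h := hasSum_discreteGaussian_smul (A := ℝ) (U := fun n => ((n.negOnePow : ℤ) : ℝ)) (by simp)
    (by simp [Int.negOnePow_add]) t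
  convert! h using 1
  rw [Real.exp_eq_exp_ℝ]
  congr 1
  simp [diffusionGenerator]
  ring

/-- The alternating sum of the kernel is `exp (-2 t)`, so the kernel determines the scale. -/
theorem discreteGaussian_injective {s t : ℝ} (h : discreteGaussian s = discreteGaussian t) :
    s = t := by
  have h1 := hasSum_discreteGaussian_alternating s
  rw [h] at h1
  have := Real.exp_injective (h1.unique (hasSum_discreteGaussian_alternating t))
  linarith

theorem hasSum_discreteGaussian_cexp (t ω : ℝ) :
    HasSum (fun n : ℤ => (discreteGaussian t n : ℂ) *
      Complex.exp (-(Complex.I * (n : ℂ) * (ω : ℂ)))) (Real.exp (t * (Real.cos ω - 1)) : ℂ) := by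
  have h := hasSum_discreteGaussian_smul (A := ℂ)
    (U := fun n => Complex.exp (-(Complex.I * (n : ℂ) * (ω : ℂ)))) (by simp)
    (by intro m n; rw [← Complex.exp_add]; congr 1; push_cast; ring) t
  simp only [Complex.real_smul] at h
  convert! h using 1
  rw [← Complex.exp_eq_exp_ℂ]
  push_cast
  congr 1
  simp [diffusionGenerator, Complex.cos]
  left
  ring_nf

/-! ### Translations of `ℓᵖ(ℤ)` -/

theorem memℓp_translate {p : ℝ≥0∞} (k : ℤ) {x : ℤ → ℝ} (hx : Memℓp x p) (hp : p ≠ 0) :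
    Memℓp (fun n => x (n - k)) p := by
  rcases p.trichotomy with rfl | rfl | h
  · exact absurd rfl hp
  · rw [memℓp_infty_iff] at hx ⊢
    exact hx.mono (by rintro _ ⟨n, rfl⟩; exact ⟨n - k, rfl⟩)
  · rw [memℓp_gen_iff h] at hx ⊢
    exact (Equiv.subRight k).summable_iff.2 hx

section
variable (p : ℝ≥0∞) [hp1 : Fact (1 ≤ p)]

/-- Translation by `k` on `ℓᵖ(ℤ)`, `x ↦ (n ↦ x (n - k))`, as a linear isometry. -/
noncomputable def translate (k : ℤ) : lp (fun _ : ℤ => ℝ) p →ₗᵢ[ℝ] lp (fun _ : ℤ => ℝ) p where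
  toFun x := ⟨fun n => x (n - k), memℓp_translate k (lp.memℓp x) (zero_lt_one.trans_le hp1.out).ne'⟩
  map_add' x y := rfl
  map_smul' c x := rfl
  norm_map' x := by
    rcases p.trichotomy with rfl | rfl | h
    · exact absurd hp1.out (by simp)
    · simp only [lp.norm_eq_ciSup]
      exact (Equiv.subRight k).iSup_comp (g := fun n => ‖x n‖)
    · rw [lp.norm_eq_tsum_rpow h, lp.norm_eq_tsum_rpow h]
      congr 1
      exact (Equiv.subRight k).tsum_eq (fun n => ‖x n‖ ^ p.toReal)

/-- Translation by `k` as an element of the Banach algebra of bounded operators on `ℓᵖ(ℤ)`. -/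
noncomputable def translateCLM (k : ℤ) :
    lp (fun _ : ℤ => ℝ) p →L[ℝ] lp (fun _ : ℤ => ℝ) p := (translate p k).toContinuousLinearMap

@[simp] theorem translateCLM_apply (k : ℤ) (x : lp (fun _ : ℤ => ℝ) p) (n : ℤ) :
    translateCLM p k x n = x (n - k) := rfl

theorem norm_translateCLM_apply (k : ℤ) (x : lp (fun _ : ℤ => ℝ) p) :
    ‖translateCLM p k x‖ = ‖x‖ := (translate p k).norm_map x

theorem norm_translateCLM_le (k : ℤ) : ‖translateCLM p k‖ ≤ 1 :=
  (translate p k).norm_toContinuousLinearMap_le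

theorem translateCLM_zero : translateCLM p 0 = 1 := by
  ext x n; simp

theorem translateCLM_add (m n : ℤ) :
    translateCLM p (m + n) = translateCLM p m * translateCLM p n := by
  ext x j; simp [sub_sub]

theorem translateCLM_single (k : ℤ) :
    translateCLM p k (lp.single p 0 (1 : ℝ)) = lp.single p k 1 := by
  ext n
  simp [Pi.single_apply, sub_eq_zero]

end

/-! ### Convolution operators and the heat semigroup -/

theorem summable_norm_smul_translateCLM (k : L1Z) :
    Summable fun m : ℤ => ‖k m • translateCLM 2 m‖ := by
  refine (lp.memℓp k).summable_of_one.norm.of_nonneg_of_le (fun _ => norm_nonneg _) fun m => ?_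
  rw [norm_smul]
  exact mul_le_of_le_one_right (norm_nonneg _) (norm_translateCLM_le 2 m)

/-- Convolution with an `ℓ¹` kernel `k`, as the norm-convergent combination `∑ₘ k m • translate m` of
translations of `ℓ²(ℤ)`; it depends continuously and linearly on the kernel. -/
noncomputable def convolutionCLM : L1Z →L[ℝ] L2Z →L[ℝ] L2Z :=
  LinearMap.mkContinuous
    { toFun := fun k => ∑' m : ℤ, k m • translateCLM 2 m
      map_add' := fun k l => by
        rw [← (summable_norm_smul_translateCLM k).of_norm.tsum_add
          (summable_norm_smul_translateCLM l).of_norm]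
        simp [add_smul]
      map_smul' := fun c k => by
        rw [RingHom.id_apply, ← tsum_const_smul'']
        simp [smul_smul] } 1 fun k => by
    have h1 : HasSum (fun m : ℤ => ‖k m‖) ‖k‖ := by
      simpa using lp.hasSum_norm (p := 1) (by simp) k
    rw [one_mul]
    refine tsum_of_norm_bounded h1 fun m => ?_
    rw [norm_smul]
    exact mul_le_of_le_one_right (norm_nonneg _) (norm_translateCLM_le 2 m)

theorem hasSum_convolutionCLM (k : L1Z) :
    HasSum (fun m : ℤ => k m • translateCLM 2 m) (convolutionCLM k) :=
  (summable_norm_smul_translateCLM k).of_norm.hasSum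

theorem hasSum_convolutionCLM_apply (k : L1Z) (x : L2Z) (n : ℤ) :
    HasSum (fun m : ℤ => k m * x (n - m)) (convolutionCLM k x n) :=
  (hasSum_convolutionCLM k).mapL
    ((lp.evalCLM ℝ (fun _ : ℤ => ℝ) 2 n).comp (ContinuousLinearMap.apply ℝ L2Z x))

/-- The impulse response of convolution with `k` is `k`. -/
theorem convolutionCLM_single (k : L1Z) (i n : ℤ) :
    convolutionCLM k (lp.single 2 i (1 : ℝ)) n = k (n - i) := by
  refine (hasSum_convolutionCLM_apply k _ n).unique ?_
  convert! hasSum_ite_eq (n - i) (k (n - i)) using 2 with m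
  rw [lp.single_apply, Pi.single_apply]
  by_cases h : m = n - i
  · subst h; simp
  · rw [if_neg h, if_neg (by omega), mul_zero]

section
variable (p : ℝ≥0∞) [Fact (1 ≤ p)]

/-- The semigroup on `ℓᵖ(ℤ)` generated by half the second difference operator. -/
noncomputable def heatSemigroup (t : ℝ) : lp (fun _ : ℤ => ℝ) p →L[ℝ] lp (fun _ : ℤ => ℝ) p :=
  exp (t • diffusionGenerator (translateCLM p))

theorem hasSum_heatSemigroup (t : ℝ) :
    HasSum (fun n : ℤ => discreteGaussian t n • translateCLM p n) (heatSemigroup p t) :=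
  hasSum_discreteGaussian_smul (translateCLM_zero p) (translateCLM_add p) t

theorem heatSemigroup_single (t : ℝ) (n : ℤ) :
    heatSemigroup p t (lp.single p 0 (1 : ℝ)) n = discreteGaussian t n := by
  have h := (hasSum_heatSemigroup p t).mapL ((lp.evalCLM ℝ (fun _ : ℤ => ℝ) p n).comp
    (ContinuousLinearMap.apply ℝ _ (lp.single p 0 (1 : ℝ))))
  refine HasSum.unique h ?_
  convert! hasSum_ite_eq n (discreteGaussian t n) using 2 with m
  change discreteGaussian t m * translateCLM p m (lp.single p 0 1) n = _
  rw [translateCLM_single, lp.single_apply, Pi.single_apply]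
  by_cases h : m = n
  · subst h; simp
  · rw [if_neg h, if_neg (Ne.symm h), mul_zero]

theorem heatSemigroup_zero : heatSemigroup p 0 = 1 := by simp [heatSemigroup]

theorem heatSemigroup_add (s t : ℝ) :
    heatSemigroup p (s + t) = heatSemigroup p s * heatSemigroup p t := by
  let _ := NormedAlgebra.restrictScalars ℚ ℝ (lp (fun _ : ℤ => ℝ) p →L[ℝ] lp (fun _ : ℤ => ℝ) p)
  rw [heatSemigroup, add_smul, exp_add_of_commute]
  · rfl
  · exact ((Commute.refl _).smul_left _).smul_right _

theorem hasDerivAt_heatSemigroup (t : ℝ) :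
    HasDerivAt (heatSemigroup p) (diffusionGenerator (translateCLM p) * heatSemigroup p t) t :=
  hasDerivAt_exp_smul_const' (𝕂 := ℝ) (diffusionGenerator (translateCLM p)) t

theorem contDiff_heatSemigroup : ContDiff ℝ 1 (heatSemigroup p) := by
  rw [contDiff_one_iff_deriv]
  refine ⟨fun t => (hasDerivAt_heatSemigroup p t).differentiableAt, ?_⟩
  have : deriv (heatSemigroup p) =
      fun t => diffusionGenerator (translateCLM p) * heatSemigroup p t :=
    funext fun t => (hasDerivAt_heatSemigroup p t).deriv
  rw [this]
  exact continuous_const.mul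
    (Differentiable.continuous (𝕜 := ℝ) fun t => (hasDerivAt_heatSemigroup p t).differentiableAt)

theorem diffusionGenerator_translateCLM_apply (x : lp (fun _ : ℤ => ℝ) p) (n : ℤ) :
    diffusionGenerator (translateCLM p) x n = (x (n - 1) + x (n + 1)) / 2 - x n := by
  change (1 / 2 : ℝ) * (x (n - 1) + x (n - -1)) - x n = _
  rw [sub_neg_eq_add]; ring

end

/-- The discrete Gaussian as an element of `ℓ¹(ℤ)`, defined as the heat semigroup applied to the unit
impulse, so that it is visibly smooth in the scale. -/
noncomputable def gaussianKernel (t : ℝ) : L1Z := heatSemigroup 1 t (lp.single 1 0 1)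

theorem gaussianKernel_apply (t : ℝ) (n : ℤ) : gaussianKernel t n = discreteGaussian t n :=
  heatSemigroup_single 1 t n

theorem convolutionCLM_eq_heatSemigroup {k : L1Z} {t : ℝ} (h : ∀ n, k n = discreteGaussian t n) :
    convolutionCLM k = heatSemigroup 2 t := by
  refine (hasSum_convolutionCLM k).unique ?_
  simpa only [h] using hasSum_heatSemigroup 2 t

/-! ### Energy decay -/

theorem eq_zero_of_translateCLM_one_eq {y : L2Z} (h : translateCLM 2 1 y = y) : y = 0 := by
  have h1 (n : ℤ) : y (n - 1) = y n := congrArg (fun z : L2Z => z n) h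
  have hc (n : ℤ) : y n = y 0 := by
    induction n with
    | zero => rfl
    | succ n ih => rw [← ih, ← h1 (n + 1)]; simp
    | pred n ih => rw [← ih, ← h1 (-n)]
  have hs := (lp.memℓp y).summable (by simp)
  simp only [hc, summable_const_iff] at hs
  ext n
  simpa [hc n] using hs

theorem inner_diffusionGenerator (y : L2Z) :
    inner ℝ y (diffusionGenerator (translateCLM 2) y) = -(‖translateCLM 2 1 y - y‖ ^ 2 / 2) := by
  -- The adjoint of a translation is its inverse.
  have h1 : inner ℝ y (translateCLM 2 (-1) y) = inner ℝ (translateCLM 2 1 y) y := by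
    rw [← (translate 2 1).inner_map_map y]
    congr 1
    change (translateCLM 2 1 * translateCLM 2 (-1)) y = y
    rw [← translateCLM_add, add_neg_cancel, translateCLM_zero]; rfl
  have h2 : diffusionGenerator (translateCLM 2) y =
      (1 / 2 : ℝ) • (translateCLM 2 1 y + translateCLM 2 (-1) y) - y := rfl
  rw [h2, norm_sub_sq_real, norm_translateCLM_apply, inner_sub_right, inner_smul_right,
    inner_add_right, h1, real_inner_comm, real_inner_self_eq_norm_sq]
  ring

theorem strictAnti_norm_heatSemigroup {x : L2Z} (hx : x ≠ 0) :
    StrictAnti fun t => ‖heatSemigroup 2 t x‖ := by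
  have hd (t : ℝ) : HasDerivAt (fun t => ‖heatSemigroup 2 t x‖ ^ 2)
      (2 * inner ℝ (heatSemigroup 2 t x)
        (diffusionGenerator (translateCLM 2) (heatSemigroup 2 t x))) t :=
    ((hasDerivAt_heatSemigroup 2 t).clm_apply (hasDerivAt_const t x)).norm_sq.congr_deriv (by simp)
  have hsq : StrictAnti fun t => ‖heatSemigroup 2 t x‖ ^ 2 := by
    refine strictAnti_of_deriv_neg fun t => ?_
    rw [(hd t).deriv, inner_diffusionGenerator]
    have hne : translateCLM 2 1 (heatSemigroup 2 t x) - heatSemigroup 2 t x ≠ 0 := fun h => by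
      have h0 := eq_zero_of_translateCLM_one_eq (sub_eq_zero.1 h)
      have h1 : heatSemigroup 2 (-t) (heatSemigroup 2 t x) = x := by
        change (heatSemigroup 2 (-t) * heatSemigroup 2 t) x = x
        rw [← heatSemigroup_add, neg_add_cancel, heatSemigroup_zero]; rfl
      rw [h0, map_zero] at h1
      exact hx h1.symm
    have := norm_pos_iff.2 hne
    nlinarith [pow_pos this 2]
  exact fun s t hst => lt_of_pow_lt_pow_left₀ 2 (norm_nonneg _) (hsq hst)

theorem antitone_norm_heatSemigroup (x : L2Z) : Antitone fun t => ‖heatSemigroup 2 t x‖ := by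
  by_cases hx : x = 0
  · subst hx; simp only [map_zero, norm_zero]; exact antitone_const
  · exact (strictAnti_norm_heatSemigroup hx).antitone

theorem isGeneralizedScalingFamily_of_eq_heatSemigroup {T : ℝ → L2Z → L2Z} {α : ℝ} (hα : 0 < α)
    (h : ∀ s, 0 ≤ s → ∀ x, T s x = heatSemigroup 2 (α * s) x) : IsGeneralizedScalingFamily T where
  consistency := by
    have hT (s : ℕ) (x : L2Z) : T s x = heatSemigroup 2 (α * s) x := h _ s.cast_nonneg x
    refine ⟨fun s _ x x' => ?_, fun s m hs hm x => ?_, fun s m hs hm => ?_⟩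
    · simp only [hT, ← map_sub]
      have := antitone_norm_heatSemigroup (x - x') (a := 0) (b := α * s) (by positivity)
      simpa [heatSemigroup_zero] using this
    · simp only [hT]
      refine antitone_norm_heatSemigroup x ?_
      gcongr
      exact Nat.le_mul_of_pos_left s (by omega)
    · have hx : (lp.single 2 0 1 : L2Z) ≠ 0 := by
        rw [← norm_ne_zero_iff, lp.norm_single (by simp)]
        simp
      refine ⟨lp.single 2 0 1, ?_⟩
      simp only [hT]
      refine strictAnti_norm_heatSemigroup hx ?_
      gcongr
      nlinarith
  differentiability x := by
    refine ContDiffOn.congr ?_ (fun s hs => h s hs x)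
    exact (((contDiff_heatSemigroup 2).comp (contDiff_const.mul contDiff_id)).clm_apply
      contDiff_const).contDiffOn

/-! ### The axioms hold for the heat semigroup -/

theorem discreteScaleSpaceAxioms_heatSemigroup {α : ℝ} (hα : 0 < α) :
    DiscreteScaleSpaceAxioms (fun s x => heatSemigroup 2 (α * s) x)
      (fun s => gaussianKernel (α * s)) := by
  have hconv (t : ℝ) : heatSemigroup 2 t = convolutionCLM (gaussianKernel t) :=
    (convolutionCLM_eq_heatSemigroup (gaussianKernel_apply t)).symm
  have hd (x : L2Z) (s : ℝ) (hs : 0 ≤ s) (n : ℤ) :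
      derivWithin (fun t : ℝ => heatSemigroup 2 (α * t) x n) (Ici 0) s =
        α * ((heatSemigroup 2 (α * s) x (n - 1) + heatSemigroup 2 (α * s) x (n + 1)) / 2 -
          heatSemigroup 2 (α * s) x n) := by
    have h1 : HasDerivAt (fun t => heatSemigroup 2 (α * t))
        (α • (diffusionGenerator (translateCLM 2) * heatSemigroup 2 (α * s))) s := by
      refine (hasDerivAt_heatSemigroup 2 (α * s)).scomp s ?_
      simpa using (hasDerivAt_id s).const_mul α
    have h2 := ((lp.evalCLM ℝ (fun _ : ℤ => ℝ) 2 n).comp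
      (ContinuousLinearMap.apply ℝ L2Z x)).hasFDerivAt.comp_hasDerivAt s h1
    rw [← diffusionGenerator_translateCLM_apply]
    exact h2.hasDerivWithinAt.derivWithin (uniqueDiffOn_Ici 0 s hs)
  exact
  { linear := fun s _ => (heatSemigroup 2 (α * s)).isLinear
    shift_invariant := fun s _ k x x' hx n => by
      simp only [hconv]
      refine (hasSum_convolutionCLM_apply _ x' n).unique ?_
      convert! hasSum_convolutionCLM_apply (gaussianKernel (α * s)) x (n - k) using 3 with m
      rw [hx, sub_right_comm]
    convolution := fun s _ x n => by
      simp only [hconv]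
      exact (hasSum_convolutionCLM_apply _ x n).tsum_eq.symm
    zero := fun x => by simp [heatSemigroup_zero]
    semigroup := fun s t _ _ x => by
      rw [mul_add, heatSemigroup_add]; rfl
    regularity :=
      (((contDiff_heatSemigroup 1).comp (contDiff_const.mul contDiff_id)).clm_apply
        contDiff_const).contDiffOn
    normalization := fun s _ => by
      simp only [gaussianKernel_apply]
      exact (hasSum_discreteGaussian _).tsum_eq
    nonenhancement_max := fun x s hs n h => by
      rw [hd x s hs n]
      exact mul_nonpos_of_nonneg_of_nonpos hα.le (by linarith [h.1, h.2])
    nonenhancement_min := fun x s hs n h => by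
      rw [hd x s hs n]
      exact mul_nonneg hα.le (by linarith [h.1, h.2])
    symmetric := fun s _ n => by
      simp only [gaussianKernel_apply, discreteGaussian_neg] }

/-! ### Classification of the families satisfying the axioms -/

/-- A one-parameter semigroup in a Banach algebra, continuous on `[0, ∞)` and differentiable from the
right at `0`, is an exponential. -/
theorem eq_exp_of_rightDeriv {A : Type*} [NormedRing A] [NormedAlgebra ℝ A] [CompleteSpace A]
    {φ : ℝ → A} {a : A} (h0 : φ 0 = 1) (hadd : ∀ s t, 0 ≤ s → 0 ≤ t → φ (s + t) = φ s * φ t)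
    (hc : ContinuousOn φ (Ici 0)) (ha : HasDerivWithinAt φ a (Ici 0) 0) {s : ℝ} (hs : 0 ≤ s) :
    φ s = exp (s • a) := by
  let _ := NormedAlgebra.restrictScalars ℚ ℝ A
  -- The semigroup law transports the right derivative from `0` to every `t ≥ 0`.
  have hright (t : ℝ) (ht : 0 ≤ t) : HasDerivWithinAt φ (φ t * a) (Ici t) t := by
    have h1 : HasDerivWithinAt (fun u => u - t) 1 (Ici t) t :=
      ((hasDerivAt_id t).sub_const t).hasDerivWithinAt
    have h2 : HasDerivWithinAt (fun u => φ t * φ (u - t)) (φ t * a) (Ici t) t := by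
      have := ha.scomp_of_eq t h1 (fun u hu => sub_nonneg.2 (mem_Ici.1 hu)) (sub_self t).symm
      rw [one_smul] at this
      exact this.const_mul (φ t)
    refine h2.congr (fun u hu => ?_) ?_
    · rw [← hadd t _ ht (sub_nonneg.2 hu), add_sub_cancel]
    · rw [sub_self, h0, mul_one]
  have hexp (t : ℝ) : HasDerivAt (fun u : ℝ => exp (u • -a)) (-a * exp (t • -a)) t :=
    hasDerivAt_exp_smul_const' (𝕂 := ℝ) (-a) t
  -- `φ t * exp (-t a)` has right derivative zero, hence keeps its value `1` at `t = 0`.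
  have hconst := constant_of_has_deriv_right_zero (f := fun t => φ t * exp (t • -a)) (a := 0)
    (b := s) ((hc.mono Icc_subset_Ici_self).mul fun t _ =>
      (hexp t).continuousAt.continuousWithinAt) (fun t ht => by
        refine ((hright t ht.1).mul (hexp t).hasDerivWithinAt).congr_deriv ?_
        rw [neg_mul, mul_neg, mul_assoc, add_neg_cancel]) s (right_mem_Icc.2 hs)
  simp only [h0, zero_smul, exp_zero, mul_one] at hconst
  have hinv : exp (s • -a) * exp (s • a) = 1 := by
    rw [← exp_add_of_commute]
    · simp
    · exact (((Commute.refl a).neg_left).smul_left _).smul_right _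
  rw [← mul_one (φ s), ← hinv, ← mul_assoc, hconst, one_mul]

/-- A symmetric kernel of total mass zero whose convolution operator is nonpositive at local maxima and
nonnegative at local minima is a nonnegative multiple of half the second difference. -/
theorem exists_convolutionCLM_eq_smul_diffusionGenerator {a : L1Z} (hsymm : ∀ n, a n = a (-n))
    (hsum : ∑' n, a n = 0)
    (hmax : ∀ (x : L2Z) (n : ℤ), IsDiscreteLocalMax x n → convolutionCLM a x n ≤ 0)
    (hmin : ∀ (x : L2Z) (n : ℤ), IsDiscreteLocalMin x n → 0 ≤ convolutionCLM a x n) :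
    ∃ β : ℝ, 0 ≤ β ∧ convolutionCLM a = β • diffusionGenerator (translateCLM 2) := by
  have hsingle (i n : ℤ) : (lp.single 2 i 1 : L2Z) n = if n = i then 1 else 0 := by
    rw [lp.single_apply, Pi.single_apply]
  -- The unit impulse at `-m` vanishes at `-1, 0, 1` if `|m| ≥ 2`, so the origin is both a local
  -- maximum and a local minimum of it, while its convolution with `a` has the value `a m` there.
  have hfar (m : ℤ) (hm : m ∉ ({-1, 0, 1} : Finset ℤ)) : a m = 0 := by
    simp only [Finset.mem_insert, Finset.mem_singleton, not_or] at hm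
    have h0 : ∀ j : ℤ, j = -1 ∨ j = 0 ∨ j = 1 → (lp.single 2 (-m) 1 : L2Z) j = 0 := by
      intro j hj; rw [hsingle, if_neg (by omega)]
    have e : convolutionCLM a (lp.single 2 (-m) 1) 0 = a m := by
      rw [convolutionCLM_single]; simp
    have hl : (lp.single 2 (-m) 1 : L2Z) (0 - 1) = 0 := h0 _ (by omega)
    have hr : (lp.single 2 (-m) 1 : L2Z) (0 + 1) = 0 := h0 _ (by omega)
    have hz : (lp.single 2 (-m) 1 : L2Z) 0 = 0 := h0 _ (by omega)
    refine le_antisymm (e ▸ hmax _ 0 ⟨?_, ?_⟩) (e ▸ hmin _ 0 ⟨?_, ?_⟩) <;>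
      simp only [hl, hr, hz, le_refl]
  -- The origin is a local maximum of the unit impulse at the origin.
  have hzero : a 0 ≤ 0 := by
    have := hmax (lp.single 2 0 1) 0 ⟨by simp, by simp⟩
    simpa [convolutionCLM_single] using this
  rw [tsum_eq_sum hfar] at hsum
  have hop := (hasSum_convolutionCLM a).unique
    (hasSum_sum_of_ne_finset_zero (s := {-1, 0, 1}) fun m hm => by rw [hfar m hm, zero_smul])
  have h1 := hsymm 1
  simp at hsum hop
  refine ⟨-a 0, by linarith, ?_⟩
  rw [hop, diffusionGenerator, translateCLM_zero, ← h1, show a 1 = -a 0 / 2 by linarith]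
  module

/-- A family satisfying the axioms is a heat semigroup with its scale multiplied by some `β ≥ 0`, and
its kernels are discrete Gaussians. -/
theorem exists_eq_heatSemigroup {T : ℝ → L2Z → L2Z} {K : ℝ → L1Z}
    (h : DiscreteScaleSpaceAxioms T K) :
    ∃ β : ℝ, 0 ≤ β ∧ (∀ s, 0 ≤ s → ∀ x, T s x = heatSemigroup 2 (β * s) x) ∧
      ∀ s, 0 ≤ s → ∀ n, K s n = discreteGaussian (β * s) n := by
  have hT (s : ℝ) (hs : 0 ≤ s) (x : L2Z) : T s x = convolutionCLM (K s) x := by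
    ext n
    rw [h.convolution s hs, (hasSum_convolutionCLM_apply (K s) x n).tsum_eq]
  have hmem : (0 : ℝ) ∈ Ici (0 : ℝ) := self_mem_Ici
  have hu : UniqueDiffWithinAt ℝ (Ici (0 : ℝ)) 0 := uniqueDiffOn_Ici 0 0 hmem
  have hK : HasDerivWithinAt K (derivWithin K (Ici 0) 0) (Ici 0) 0 :=
    (h.regularity.differentiableOn one_ne_zero 0 hmem).hasDerivWithinAt
  set a := derivWithin K (Ici 0) 0
  have hφ : HasDerivWithinAt (fun s => convolutionCLM (K s)) (convolutionCLM a) (Ici 0) 0 :=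
    convolutionCLM.hasFDerivAt.comp_hasDerivWithinAt 0 hK
  have hKn (n : ℤ) : HasDerivWithinAt (fun s => K s n) (a n) (Ici 0) 0 :=
    (lp.evalCLM ℝ (fun _ : ℤ => ℝ) 1 n).hasFDerivAt.comp_hasDerivWithinAt 0 hK
  have hTd (x : L2Z) (n : ℤ) :
      derivWithin (fun t => T t x n) (Ici 0) 0 = convolutionCLM a x n := by
    have h1 := ((lp.evalCLM ℝ (fun _ : ℤ => ℝ) 2 n).comp
      (ContinuousLinearMap.apply ℝ L2Z x)).hasFDerivAt.comp_hasDerivWithinAt 0 hφ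
    refine HasDerivWithinAt.derivWithin ?_ hu
    refine HasDerivWithinAt.congr h1 (fun s hs => ?_) ?_
    · rw [hT s hs]; rfl
    · rw [hT 0 le_rfl]; rfl
  have hsymm (n : ℤ) : a n = a (-n) := by
    refine hu.eq_deriv _ (hKn n) ((hKn (-n)).congr (fun s hs => h.symmetric s hs n) ?_)
    exact h.symmetric 0 le_rfl n
  have hsum : ∑' n, a n = 0 := by
    have h1 : HasDerivWithinAt (fun s => ∑' n, K s n) (∑' n, a n) (Ici 0) 0 :=
      (lp.tsumCLM (𝕜 := ℝ) ℤ ℝ).hasFDerivAt.comp_hasDerivWithinAt 0 hK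
    refine hu.eq_deriv _ h1 ((hasDerivWithinAt_const 0 (Ici 0) (1 : ℝ)).congr
      (fun s hs => h.normalization s hs) (h.normalization 0 le_rfl))
  obtain ⟨β, hβ, hA⟩ := exists_convolutionCLM_eq_smul_diffusionGenerator hsymm hsum
    (fun x n hx => by
      rw [← hTd]; exact h.nonenhancement_max x 0 le_rfl n (by rwa [h.zero]))
    (fun x n hx => by
      rw [← hTd]; exact h.nonenhancement_min x 0 le_rfl n (by rwa [h.zero]))
  have hexp (s : ℝ) (hs : 0 ≤ s) : convolutionCLM (K s) = heatSemigroup 2 (β * s) := by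
    rw [eq_exp_of_rightDeriv (φ := fun s => convolutionCLM (K s)) ?_ ?_ ?_ hφ hs, hA, smul_smul,
      mul_comm, heatSemigroup]
    · ext1 x; rw [← hT 0 le_rfl, h.zero]; rfl
    · intro s t hs ht
      ext1 x
      rw [← hT _ (add_nonneg hs ht), h.semigroup s t hs ht, hT s hs, hT t ht]; rfl
    · exact convolutionCLM.continuous.comp_continuousOn h.regularity.continuousOn
  refine ⟨β, hβ, fun s hs x => by rw [hT s hs, hexp s hs], fun s hs n => ?_⟩
  have := convolutionCLM_single (K s) 0 n
  rw [hexp s hs, heatSemigroup_single, sub_zero] at this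
  exact this.symm

/-! ### The Fourier symbol -/

theorem norm_mul_cexp_int_mul (c : ℝ) (j : ℤ) (ω : ℝ) :
    ‖(c : ℂ) * Complex.exp ((j : ℂ) * Complex.I * ω)‖ = ‖c‖ := by
  have : (j : ℂ) * Complex.I * ω = ((j * ω : ℝ) : ℂ) * Complex.I := by push_cast; ring
  rw [norm_mul, this, Complex.norm_exp_ofReal_mul_I, mul_one, Complex.norm_real]

theorem integral_cexp_int_mul (j : ℤ) :
    ∫ ω in (-Real.pi)..Real.pi, Complex.exp ((j : ℂ) * Complex.I * ω) =
      if j = 0 then 2 * (Real.pi : ℂ) else 0 := by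
  split_ifs with hj
  · subst hj
    simp [two_mul]
  · have hc : (j : ℂ) * Complex.I ≠ 0 := mul_ne_zero (Int.cast_ne_zero.2 hj) Complex.I_ne_zero
    have : Complex.exp ((j : ℂ) * Complex.I * (Real.pi : ℂ)) =
        Complex.exp ((j : ℂ) * Complex.I * ((-Real.pi : ℝ) : ℂ)) :=
      Complex.exp_eq_exp_iff_exists_int.2 ⟨j, by push_cast; ring⟩
    rw [integral_exp_mul_complex hc, this, sub_self, zero_div]

theorem summable_fourierSymbol (k : L1Z) (ω : ℝ) :
    Summable fun n : ℤ => (k n : ℂ) * Complex.exp (-(Complex.I * (n : ℂ) * (ω : ℂ))) := by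
  refine ((lp.memℓp k).summable_of_one.norm).of_norm_bounded fun n => ?_
  rw [← norm_mul_cexp_int_mul (k n) (-n) ω]
  apply le_of_eq
  congr 3
  push_cast
  ring

/-- Injectivity of the Fourier symbol: the integral of `e^{imω} ∑ₙ d n e^{-inω}` over `[-π, π]` is
`2 π d m`. -/
theorem eq_zero_of_fourierSymbol_eq_zero {d : L1Z}
    (h : ∀ ω ∈ Icc (-Real.pi) Real.pi, fourierSymbol d ω = 0) (m : ℤ) : d m = 0 := by
  have hd : Summable fun n => ‖d n‖ := (lp.memℓp d).summable_of_one.norm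
  have hle : -Real.pi ≤ Real.pi := by linarith [Real.pi_pos]
  have hS := intervalIntegral.hasSum_integral_of_dominated_convergence (a := -Real.pi)
    (b := Real.pi) (μ := MeasureTheory.volume) (f := fun _ => (0 : ℂ))
    (F := fun (n : ℤ) ω => (d n : ℂ) * Complex.exp (((m - n : ℤ) : ℂ) * Complex.I * ω))
    (fun n _ => ‖d n‖) (fun n => (by fun_prop : Continuous _).aestronglyMeasurable)
    (fun n => .of_forall fun ω _ => (norm_mul_cexp_int_mul _ _ _).le) (.of_forall fun _ _ => hd)
    intervalIntegrable_const (.of_forall fun ω hω => by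
      rw [uIoc_of_le hle] at hω
      have h1 := (summable_fourierSymbol d ω).hasSum.mul_left (Complex.exp (m * Complex.I * ω))
      rw [← fourierSymbol, h ω (Ioc_subset_Icc_self hω), mul_zero] at h1
      convert! h1 using 2 with n
      rw [mul_left_comm, ← Complex.exp_add]
      congr 2
      push_cast
      ring)
  simp only [intervalIntegral.integral_const_mul, integral_cexp_int_mul,
    intervalIntegral.integral_zero, sub_eq_zero] at hS
  have h2 := hS.unique (hasSum_single m fun n hn => by rw [if_neg hn.symm, mul_zero])
  simpa [Real.pi_ne_zero] using h2

theorem eq_discreteGaussian_iff_fourierSymbol (t : ℝ) (k : L1Z) :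
    (∀ n : ℤ, k n = discreteGaussian t n) ↔ ∀ ω ∈ Icc (-Real.pi) Real.pi,
      fourierSymbol k ω = (Real.exp (t * (Real.cos ω - 1)) : ℂ) := by
  constructor
  · intro h ω _
    simp only [fourierSymbol, h]
    exact (hasSum_discreteGaussian_cexp t ω).tsum_eq
  · intro h n
    have := eq_zero_of_fourierSymbol_eq_zero (d := k - gaussianKernel t) (fun ω hω => by
      have h1 := (summable_fourierSymbol k ω).hasSum.sub (hasSum_discreteGaussian_cexp t ω)
      rw [← fourierSymbol, h ω hω, sub_self] at h1
      rw [fourierSymbol, ← h1.tsum_eq]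
      congr 1
      funext n
      rw [lp.coeFn_sub, Pi.sub_apply, gaussianKernel_apply]
      push_cast
      ring) n
    rwa [lp.coeFn_sub, Pi.sub_apply, gaussianKernel_apply, sub_eq_zero] at this

/-! ### Uniqueness, rescaling and the trivial family -/

theorem pos_of_isGeneralizedScalingFamily {T : ℝ → L2Z → L2Z} {β : ℝ} (hβ : 0 ≤ β)
    (hT : ∀ s, 0 ≤ s → ∀ x, T s x = heatSemigroup 2 (β * s) x)
    (h : IsGeneralizedScalingFamily T) : 0 < β := by
  refine hβ.lt_of_ne fun h0 => ?_
  subst h0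
  obtain ⟨x, hx⟩ := h.consistency.energy_lt 1 2 le_rfl one_lt_two
  simp only [hT _ (Nat.cast_nonneg _), zero_mul, lt_irrefl] at hx

theorem existsUnique_rate {T : ℝ → L2Z → L2Z} {K : ℝ → L1Z} (h : DiscreteScaleSpaceAxioms T K)
    (hg : IsGeneralizedScalingFamily T) :
    ∃! α : ℝ, 0 < α ∧ ∀ s, 0 ≤ s → ∀ n : ℤ, K s n = discreteGaussian (α * s) n := by
  obtain ⟨β, hβ, hT, hK⟩ := exists_eq_heatSemigroup h
  refine ⟨β, ⟨pos_of_isGeneralizedScalingFamily hβ hT hg, hK⟩, fun α hα => ?_⟩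
  have := discreteGaussian_injective (s := α * 1) (t := β * 1)
    (funext fun n => by rw [← hK 1 zero_le_one, ← hα.2 1 zero_le_one])
  simpa using this

theorem exists_rescaling {T T' : ℝ → L2Z → L2Z} {K K' : ℝ → L1Z}
    (h : DiscreteScaleSpaceAxioms T K) (hg : IsGeneralizedScalingFamily T)
    (h' : DiscreteScaleSpaceAxioms T' K') (hg' : IsGeneralizedScalingFamily T') :
    ∃ c : ℝ, 0 < c ∧ ∀ s, 0 ≤ s → T' s = T (c * s) ∧ K' s = K (c * s) := by
  obtain ⟨β, hβ, hT, hK⟩ := exists_eq_heatSemigroup h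
  obtain ⟨β', hβ', hT', hK'⟩ := exists_eq_heatSemigroup h'
  have hpos := pos_of_isGeneralizedScalingFamily hβ hT hg
  have hpos' := pos_of_isGeneralizedScalingFamily hβ' hT' hg'
  refine ⟨β' / β, div_pos hpos' hpos, fun s hs => ?_⟩
  have hcs : 0 ≤ β' / β * s := by positivity
  have e : β * (β' / β * s) = β' * s := by field_simp
  constructor
  · funext x; rw [hT' s hs, hT _ hcs, e]
  · ext n; rw [hK' s hs, hK _ hcs, e]

theorem isGeneralizedScalingFamily_iff {T : ℝ → L2Z → L2Z} {K : ℝ → L1Z}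
    (h : DiscreteScaleSpaceAxioms T K) :
    IsGeneralizedScalingFamily T ↔ ∃ s, 0 ≤ s ∧ T s ≠ id := by
  obtain ⟨β, hβ, hT, -⟩ := exists_eq_heatSemigroup h
  constructor
  · intro hg
    by_contra! hid
    obtain ⟨x, hx⟩ := hg.consistency.energy_lt 1 2 le_rfl one_lt_two
    simp only [hid _ (Nat.cast_nonneg _), lt_irrefl] at hx
  · rintro ⟨s, hs, hne⟩
    refine isGeneralizedScalingFamily_of_eq_heatSemigroup (hβ.lt_of_ne fun h0 => hne ?_) hT
    funext x
    rw [hT s hs, ← h0, zero_mul, heatSemigroup_zero]; rfl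

end ScaleSpace

theorem theorem4p4 :
    -- existence: every positive rescaling of the discrete Gaussian has all the properties
    (∀ α : ℝ, 0 < α →
      ∃ (T : ℝ → ScaleSpace.L2Z → ScaleSpace.L2Z) (K : ℝ → ScaleSpace.L1Z),
        ScaleSpace.DiscreteScaleSpaceAxioms T K ∧
        ScaleSpace.IsGeneralizedScalingFamily T ∧
        ∀ s, 0 ≤ s → ∀ n : ℤ, K s n = ScaleSpace.discreteGaussian (α * s) n) ∧
    -- uniqueness: there is no other family, and the rescaling factor is determined
    (∀ (T : ℝ → ScaleSpace.L2Z → ScaleSpace.L2Z) (K : ℝ → ScaleSpace.L1Z),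
      ScaleSpace.DiscreteScaleSpaceAxioms T K → ScaleSpace.IsGeneralizedScalingFamily T →
        ∃! α : ℝ, 0 < α ∧
          ∀ s, 0 ≤ s → ∀ n : ℤ, K s n = ScaleSpace.discreteGaussian (α * s) n) ∧
    -- any two such families differ only by a rescaling of the scale
    (∀ (T T' : ℝ → ScaleSpace.L2Z → ScaleSpace.L2Z) (K K' : ℝ → ScaleSpace.L1Z),
      ScaleSpace.DiscreteScaleSpaceAxioms T K → ScaleSpace.IsGeneralizedScalingFamily T →
      ScaleSpace.DiscreteScaleSpaceAxioms T' K' → ScaleSpace.IsGeneralizedScalingFamily T' →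
        ∃ c : ℝ, 0 < c ∧ ∀ s, 0 ≤ s → T' s = T (c * s) ∧ K' s = K (c * s)) ∧
    -- under the axioms, only the trivial family fails to be a generalized scaling family
    (∀ (T : ℝ → ScaleSpace.L2Z → ScaleSpace.L2Z) (K : ℝ → ScaleSpace.L1Z),
      ScaleSpace.DiscreteScaleSpaceAxioms T K →
        (ScaleSpace.IsGeneralizedScalingFamily T ↔ ∃ s, 0 ≤ s ∧ T s ≠ id)) ∧
    -- the equivalent description by the Fourier symbol, in its two forms
    (∀ (α s : ℝ), 0 < α → 0 ≤ s → ∀ k : ScaleSpace.L1Z,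
      ((∀ n : ℤ, k n = ScaleSpace.discreteGaussian (α * s) n) ↔
        ∀ ω ∈ Set.Icc (-Real.pi) Real.pi,
          ScaleSpace.fourierSymbol k ω = (Real.exp (α * s * (Real.cos ω - 1)) : ℂ)) ∧
      ((∀ n : ℤ, k n = ScaleSpace.discreteGaussian (α * s) n) ↔
        ∀ ω ∈ Set.Icc (-Real.pi) Real.pi,
          ScaleSpace.fourierSymbol k ω =
            (Real.exp (-2 * α * s * Real.sin (ω / 2) ^ 2) : ℂ))) := by
  refine ⟨fun α hα => ⟨_, _, ScaleSpace.discreteScaleSpaceAxioms_heatSemigroup hα,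
      ScaleSpace.isGeneralizedScalingFamily_of_eq_heatSemigroup hα fun _ _ _ => rfl,
      fun s _ => ScaleSpace.gaussianKernel_apply (α * s)⟩,
    fun _ _ => ScaleSpace.existsUnique_rate, fun _ _ _ _ => ScaleSpace.exists_rescaling,
    fun _ _ => ScaleSpace.isGeneralizedScalingFamily_iff, fun α s _ _ k => ?_⟩
  have h := ScaleSpace.eq_discreteGaussian_iff_fourierSymbol (α * s) k
  have e (ω : ℝ) : α * s * (Real.cos ω - 1) = -2 * α * s * Real.sin (ω / 2) ^ 2 := by
    rw [Real.sin_sq_eq_half_sub, mul_div_cancel₀ ω two_ne_zero]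
    ring
  refine ⟨h, ?_⟩
  simp only [← e]
  exact h
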